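/- For $p\in[1,\infty]$, $C\subseteq\mathbb{R}^n$ and $\varepsilon\ge 0$ let $B_p(C,\varepsilon)=\{x:\exists y\in C,\ \|x-y\|_p\le\varepsilon\}$, $B_p(x,\varepsilon)=B_p(\{x\},\varepsilon)$ and $B_p(C,-\varepsilon)=\{x: B_p(x,\varepsilon)\subseteq C\}$. Call $K\subseteq\mathbb{R}^n$ admissible if it is convex, $K\subseteq B_\infty(0,2)$, and there is an $x\in\mathbb{R}^n$ with $B_\infty(x,1/3)\subseteq K$. *Oracle.* A strong separation query to $K$ is a vector $y$; a correct answer is either the assertion $y\in K$, or the assertion $y\notin K$ together with a vector $g$, $\|g\|_2=1$, such that $\langle g,x\rangle\le\langle g,y\rangle$ for all $x\in K$. Vectors are stored with finite precision: there are a finite set $V$ of codewords and a map $V\to\mathbb{R}^n$, of arbitrary precision and range, such that each of the vectors $\pm e_1,\dots,\pm e_n$ is represented. A quantum separation oracle $\mathrm{SEP}_{0,0}(K)$ is a unitary $U$ on a query register, an answer register and a finite ancilla register such that, for every codeword $v$, $U|v,0,0\rangle=\sum_a\alpha_{v,a}|v,a,\psi_{v,a}\rangle$ with unit vectors $\psi_{v,a}$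 and $\sum_{a\text{ correct for }v}|\alpha_{v,a}|^2\ge 1$. A $T$-query quantum algorithm uses finitely many qubits, alternates fixed unitaries (independent of $K$ and $U$) with $T$ queries, each an application of $U$ or $U^{-1}$ (possibly controlled), and ends with a measurement that determines its output. **Theorem.** For every $\rho<1/2$ there is a constant $\kappa>0$ such that for every $n$, every such finite-precision representation of vectors and every ancilla register the following hold. 1. If a $T$-query quantum algorithm outputs, for every admissible $K\subseteq\mathbb{R}^n$ and every quantum oracle $\mathrm{SEP}_{0,0}(K)$, a point of $B_\infty(K,1/7)$ with probability at least $1-\rho$, then $T\ge\kappa n$. That is, finding a point in $B_\infty(K,1/7)$ for an unknown admissible $K$ requires $\Omega(n)$ quantum queries to a strong separation oracle. 2. Hence optimization without a known interior point needs $\Omega(n)$ quantum separation queries: let $0\le\varepsilon\le 1/7$ and $c\in\mathbb{R}^n$ with $\|c\|_2=1$. If a $T$-query quantum algorithm, for every admissible $K\subseteq\mathbb{R}^n$ and every quantum oracle $\mathrm{SEP}_{0,0}(K)$, with probability at least $1-\rho$ either outputs some $y\in B_2(K,\varepsilon)$ with $\langle c,x\rangle\le\langle c,y\rangle+\varepsilon$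 for all $x\in B_2(K,-\varepsilon)$, or correctly asserts that $B_2(K,-\varepsilon)$ is empty, then $T\ge\kappa n$. -/

import Mathlib

open scoped ENNReal

noncomputable section

namespace ConvexOracle

/-! ### Balls around sets, in the `ℓ_p` norm -/

/-- `B_p(C, ε)`: the points at `ℓ_p`-distance at most `ε` from a point of `C`. -/
def ballAround {n : ℕ} (p : ℝ≥0∞) (C : Set (Fin n → ℝ)) (ε : ℝ) : Set (Fin n → ℝ) :=
  {x | ∃ y ∈ C, ‖WithLp.toLp p (x - y)‖ ≤ ε}

/-- `B_p(C, -ε)`: the points whose closed `ℓ_p`-ball of radius `ε` is contained in `C`. -/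
def innerPart {n : ℕ} (p : ℝ≥0∞) (C : Set (Fin n → ℝ)) (ε : ℝ) : Set (Fin n → ℝ) :=
  {x | ballAround p {x} ε ⊆ C}

/-- The promise on the unknown set: `K` is convex, `K ⊆ B_∞(0, 2)`, and `K` contains some box
`B_∞(x, 1/3)`. -/
def Admissible {n : ℕ} (K : Set (Fin n → ℝ)) : Prop :=
  Convex ℝ K ∧ K ⊆ ballAround ∞ {0} 2 ∧ ∃ x : Fin n → ℝ, ballAround ∞ {x} (1 / 3) ⊆ K

/-! ### Correct answers to separation and optimization queries -/

/-- Correct answers to the query `y` of a separation oracle for `K` with precision `ε`. The answer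
`none` asserts `y ∈ B_2(K, ε)`; the answer `some g` asserts `y ∉ B_2(K, -ε)` and gives a
separating unit vector `g`. -/
def sepAnswers {n : ℕ} (ε : ℝ) (K : Set (Fin n → ℝ)) (y : Fin n → ℝ) :
    Set (Option (Fin n → ℝ)) :=
  {a | match a with
    | none => y ∈ ballAround 2 K ε
    | some g => y ∉ innerPart 2 K ε ∧ ‖WithLp.toLp 2 g‖ = 1 ∧
        ∀ x ∈ innerPart 2 K ε, g ⬝ᵥ x ≤ g ⬝ᵥ y + ε}

/-- Correct answers to the query `c` (a unit vector) of an optimization oracle for `K` with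
precision `ε`. The answer `none` asserts that `B_2(K, -ε)` is empty. -/
def optAnswers {n : ℕ} (ε : ℝ) (K : Set (Fin n → ℝ)) (c : Fin n → ℝ) :
    Set (Option (Fin n → ℝ)) :=
  {a | match a with
    | none => innerPart 2 K ε = ∅
    | some y => y ∈ ballAround 2 K ε ∧ ∀ x ∈ innerPart 2 K ε, c ⬝ᵥ x ≤ c ⬝ᵥ y + ε}

/-! ### Relational quantum oracles

A register with the finite set `X` of basis states has state space `X → ℂ`. -/

/-- The unitary `U`, acting on a query register `X`, an answer register `Y` and an ancilla
register `W` with blank states `|y₀⟩` and `|w₀⟩`, is a relational quantum oracle for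
`F : X → 𝒫(Y)` with success probability at least `1 - ρ`:
`U |x, y₀, w₀⟩ = ∑_y α_{x,y} |x, y, ψ_{x,y}⟩` with unit vectors `ψ_{x,y}` and
`∑_{y ∈ F x} |α_{x,y}|² ≥ 1 - ρ`. -/
def IsRelationalOracle {X Y W : Type} [Fintype X] [DecidableEq X] [Fintype Y] [DecidableEq Y]
    [Fintype W] [DecidableEq W] (y₀ : Y) (w₀ : W) (F : X → Set Y) (ρ : ℝ)
    (U : Matrix.unitaryGroup (X × Y × W) ℂ) : Prop :=
  ∃ (α : X → Y → ℂ) (ψ : X → Y → W → ℂ),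
    (∀ x y, ∑ w, ‖ψ x y w‖ ^ 2 = 1) ∧
    (∀ x x' y w, U.1 (x', y, w) (x, y₀, w₀) = if x' = x then α x y * ψ x y w else 0) ∧
    ∀ x, 1 - ρ ≤ ∑ y, (F x).indicator (fun y => ‖α x y‖ ^ 2) y

/-- `U` is a quantum separation oracle `SEP_{ε,ρ}(K)`. Vectors are held in registers with a finite
set `V` of codewords, `v` standing for the vector `dec v`; the answer register holds `none` or a
codeword, and its blank state is `none`. -/
def IsSepOracle {n : ℕ} {V W : Type} [Fintype V] [DecidableEq V] [Fintype W] [DecidableEq W]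
    (dec : V → Fin n → ℝ) (w₀ : W) (ε ρ : ℝ) (K : Set (Fin n → ℝ))
    (U : Matrix.unitaryGroup (V × Option V × W) ℂ) : Prop :=
  IsRelationalOracle none w₀ (fun v => {a : Option V | a.map dec ∈ sepAnswers ε K (dec v)}) ρ U

/-! ### Quantum query algorithms -/

/-- A quantum algorithm making `queries` queries to an unknown unitary on a register with basis
states `R`, with outputs in `O`. Besides the oracle register it has a control register (basis
`-1, 0, 1`) and a finite workspace `Work`. It starts in a basis state, alternates the fixed
unitaries `gate t` with queries, measures all registers in the computational basis, and outputs
`output b` on the measurement result `b`. -/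
structure QueryAlgorithm (R : Type) [Fintype R] [DecidableEq R] (O : Type) where
  Work : Type
  [fintypeWork : Fintype Work]
  [decidableEqWork : DecidableEq Work]
  queries : ℕ
  gate : ℕ → Matrix.unitaryGroup (SignType × R × Work) ℂ
  start : SignType × R × Work
  output : SignType × R × Work → O

namespace QueryAlgorithm

attribute [instance] QueryAlgorithm.fintypeWork QueryAlgorithm.decidableEqWork

variable {R : Type} [Fintype R] [DecidableEq R] {O : Type}

/-- One query: `|s⟩|r⟩|a⟩ ↦ |s⟩ (U^s |r⟩) |a⟩` for `s = -1, 0, 1`. Thus the algorithm may apply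
`U` or its inverse, also conditionally and in superposition. -/
def queryOp (A : QueryAlgorithm R O) (U : Matrix.unitaryGroup R ℂ) :
    Matrix (SignType × R × A.Work) (SignType × R × A.Work) ℂ :=
  Matrix.of fun b b' => if b.1 = b'.1 ∧ b.2.2 = b'.2.2 then (U ^ (b.1 : ℤ)).1 b.2.1 b'.2.1 else 0

/-- The state after `t` queries, each of them followed by a gate. -/
def state (A : QueryAlgorithm R O) (U : Matrix.unitaryGroup R ℂ) :
    ℕ → SignType × R × A.Work → ℂ
  | 0 => (A.gate 0).1.mulVec (Pi.single A.start 1)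
  | t + 1 => (A.gate (t + 1)).1.mulVec ((A.queryOp U).mulVec (A.state U t))

/-- The probability that the output lies in `S` when the queries are answered by `U`. -/
def outputProb (A : QueryAlgorithm R O) (U : Matrix.unitaryGroup R ℂ) (S : Set O) : ℝ :=
  ∑ b, (A.output ⁻¹' S).indicator (fun b => ‖A.state U A.queries b‖ ^ 2) b

end QueryAlgorithm

end ConvexOracle

end

/-!
The hard sets are the `2 ^ n` boxes `B_∞(c, 1/3)` around the vertices `c ∈ {-1, 1}ⁿ`, encoded by
strings `z : Fin n → Bool`. A point close to such a box, and likewise a correct answer to the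
optimization query, determines the vertex (`disjoint_ballAround_box`, `disjoint_optAnswers_box`), so
the algorithm has to identify `z`.

The oracle reports the first coordinate in which the query violates a constraint of the box. A query
`y` then tells apart two strings that first differ at position `k` only if `y` satisfies the first
`k` constraints of both, that is, only if the signs of `y` spell out the common prefix of the
strings (`eq_sign_of_boxAnswer_ne`). As a quantum oracle it is a permutation of the basis states.

The number of queries is bounded by the adversary method with positive weights. Give a pair of
strings that first differ at `k` the weight `2 ^ (k + 1)`, and let the potential be the weighted sum
of the squared distances of the states of the algorithm on the two inputs. It starts at `0`. At the
end it is at least a constant times `n * 4 ^ n`, since the total weight is `n * 4 ^ n` (`sum_weight`)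
and states that lead to disjoint sets of outcomes with probability above `1 / 2` are far apart
(`sq_le_norm_sub_sq_of_disjoint`). A query changes it by at most `20 * 4 ^ n`: by
`norm_comp_sub_comp_sq_le` the increase is controlled, for every value of the query register, by
the bilinear form of the weights restricted to the pairs that this value tells apart. Those pairs
branch off a single path of the binary tree, and there the weights decay geometrically relative to
the sizes of the branches, so that the form has norm at most `5 * 2 ^ n`, without a factor `n`
(`sum_weight_mul_le`).
-/

noncomputable section

namespace ConvexOracle

/-! ### Binary strings and their first difference -/

/-- The strings that agree with `s` in the first `k` positions. -/
def cylinder {n : ℕ} (s : Fin n → Bool) (k : ℕ) : Finset (Fin n → Bool) :=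
  Finset.univ.filter fun z => ∀ i : Fin n, i.val < k → z i = s i

/-- The strings whose first difference from `s` is at position `k` (empty if `n ≤ k`). -/
def branch {n : ℕ} (s : Fin n → Bool) (k : ℕ) : Finset (Fin n → Bool) :=
  cylinder s k \ cylinder s (k + 1)

/-- `k` is the first position at which `z` and `z'` differ. -/
def SplitAt {n : ℕ} (z z' : Fin n → Bool) (k : Fin n) : Prop :=
  (∀ i < k, z i = z' i) ∧ z k ≠ z' k

instance {n : ℕ} (z z' : Fin n → Bool) (k : Fin n) : Decidable (SplitAt z z' k) :=
  inferInstanceAs (Decidable (_ ∧ _))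

theorem mem_cylinder {n : ℕ} {s z : Fin n → Bool} {k : ℕ} :
    z ∈ cylinder s k ↔ ∀ i : Fin n, i.val < k → z i = s i := by
  simp [cylinder]

theorem cylinder_zero {n : ℕ} (s : Fin n → Bool) : cylinder s 0 = Finset.univ := by
  simp [cylinder]

theorem cylinder_self {n : ℕ} (s : Fin n → Bool) : cylinder s n = {s} := by
  ext z
  simp [mem_cylinder, funext_iff]

theorem cylinder_succ_subset {n : ℕ} (s : Fin n → Bool) (k : ℕ) :
    cylinder s (k + 1) ⊆ cylinder s k := fun z hz =>
  mem_cylinder.2 fun i hi => mem_cylinder.1 hz i (by omega)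

theorem mem_cylinder_succ {n : ℕ} {s z : Fin n → Bool} {k : Fin n} :
    z ∈ cylinder s (k + 1) ↔ (∀ i < k, z i = s i) ∧ z k = s k := by
  rw [mem_cylinder]
  refine ⟨fun h => ⟨fun i hi => h i (by have := Fin.lt_def.1 hi; omega), h k (by omega)⟩,
    fun h i hi => ?_⟩
  rcases eq_or_ne i k with rfl | hne
  · exact h.2
  · exact h.1 i (Fin.lt_def.2 (by have := Fin.val_ne_of_ne hne; omega))

theorem mem_branch {n : ℕ} {s z : Fin n → Bool} {k : Fin n} :
    z ∈ branch s k ↔ SplitAt s z k := by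
  rw [branch, Finset.mem_sdiff, mem_cylinder_succ, mem_cylinder, SplitAt]
  simp only [Fin.lt_def, @eq_comm _ (s _)]
  tauto

theorem card_cylinder {n : ℕ} (s : Fin n → Bool) {k : ℕ} (hk : k ≤ n) :
    (cylinder s k).card = 2 ^ (n - k) := by
  have h : cylinder s k =
      Fintype.piFinset fun i : Fin n => if i.val < k then {s i} else Finset.univ := by
    ext z
    simp only [mem_cylinder, Fintype.mem_piFinset]
    refine forall_congr' fun i => ?_
    split_ifs with hi <;> simp [hi]
  rw [h, Fintype.card_piFinset]
  have h2 : ∀ i : Fin n, (if i.val < k then {s i} else (Finset.univ : Finset Bool)).card =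
      if i.val < k then 1 else 2 := fun i => by split_ifs <;> simp
  simp only [h2]
  rw [Fin.prod_univ_eq_prod_range (fun i => if i < k then 1 else 2) n,
    ← Finset.prod_range_mul_prod_Ico _ hk,
    Finset.prod_congr rfl fun i hi => if_pos (Finset.mem_range.1 hi),
    Finset.prod_congr rfl fun i hi => if_neg (not_lt.2 (Finset.mem_Ico.1 hi).1)]
  simp

theorem two_pow_mul_card_branch {n : ℕ} (s : Fin n → Bool) {k : ℕ} (hk : k < n) :
    (2 : ℝ) ^ (k + 1) * (branch s k).card = 2 ^ n := by
  have h := Finset.card_sdiff_add_card_eq_card (cylinder_succ_subset s k)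
  rw [card_cylinder s (show k + 1 ≤ n from hk), card_cylinder s hk.le,
    show n - k = n - (k + 1) + 1 by omega,
    pow_succ] at h
  have h' : (branch s k).card = 2 ^ (n - (k + 1)) := by
    rw [branch]; omega
  rw [h', Nat.cast_pow, Nat.cast_ofNat, ← pow_add]
  congr 1
  omega

/-- One step of the telescoping sum behind `sum_two_pow_mul_branch_mul_cylinder_le`. The term
`2 * 2 ^ k * (∑ z ∈ cylinder s k, a z) ^ 2` is a potential that absorbs the cross terms. -/
theorem branch_step {n : ℕ} (s : Fin n → Bool) (a : (Fin n → Bool) → ℝ) {k : ℕ} (hk : k < n) :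
    2 ^ (k + 1) * (2 * ((∑ z ∈ branch s k, a z) * ∑ z ∈ cylinder s (k + 1), a z)) +
        2 * 2 ^ k * (∑ z ∈ cylinder s k, a z) ^ 2 ≤
      5 * 2 ^ n * ((∑ z ∈ cylinder s k, a z ^ 2) - ∑ z ∈ cylinder s (k + 1), a z ^ 2) +
        2 * 2 ^ (k + 1) * (∑ z ∈ cylinder s (k + 1), a z) ^ 2 := by
  have h1 := Finset.sum_sdiff (f := a) (cylinder_succ_subset s k)
  have h2 := Finset.sum_sdiff (f := fun z => a z ^ 2) (cylinder_succ_subset s k)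
  have h3 := sq_sum_le_card_mul_sum_sq (s := branch s k) (f := a)
  have h4 := two_pow_mul_card_branch s hk
  change ∑ z ∈ branch s k, _ + _ = _ at h1
  change ∑ z ∈ branch s k, _ + _ = _ at h2
  have h5 := mul_le_mul_of_nonneg_left h3 (show (0 : ℝ) ≤ 2 ^ (k + 1) by positivity)
  rw [← mul_assoc, h4] at h5
  rw [← h1, ← h2]
  generalize (∑ z ∈ branch s k, a z) = X at *
  generalize (∑ z ∈ cylinder s (k + 1), a z) = Y at *
  have hk2 : (0 : ℝ) < 2 ^ k := by positivity
  -- after the bound `h5` and division by `2 ^ (k + 1)`, the gap is the square `(2 X - Y) ^ 2`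
  have h6 := mul_nonneg hk2.le (sq_nonneg (2 * X - Y))
  rw [pow_succ] at h5 ⊢
  linarith

/-- The spectral bound behind the adversary method: only the pairs that split at a prefix of `s`
count, and with the weight `2 ^ (k + 1)` for a split at `k` their bilinear form has norm at most
`5 * 2 ^ n`, independently of the number of levels. -/
theorem sum_two_pow_mul_branch_mul_cylinder_le {n : ℕ} (s : Fin n → Bool)
    (a : (Fin n → Bool) → ℝ) :
    ∑ k ∈ Finset.range n,
        2 ^ (k + 1) * (2 * ((∑ z ∈ branch s k, a z) * ∑ z ∈ cylinder s (k + 1), a z)) ≤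
      5 * 2 ^ n * ∑ z, a z ^ 2 := by
  have key : ∀ m ≤ n, ∑ k ∈ Finset.range m,
        2 ^ (k + 1) * (2 * ((∑ z ∈ branch s k, a z) * ∑ z ∈ cylinder s (k + 1), a z)) +
          2 * 2 ^ 0 * (∑ z ∈ cylinder s 0, a z) ^ 2 ≤
      5 * 2 ^ n * ((∑ z ∈ cylinder s 0, a z ^ 2) - ∑ z ∈ cylinder s m, a z ^ 2) +
        2 * 2 ^ m * (∑ z ∈ cylinder s m, a z) ^ 2 := by
    intro m
    induction m with
    | zero => simp
    | succ m ih =>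
      intro hm
      have h1 := ih (by omega)
      have h2 := branch_step s a (show m < n by omega)
      rw [Finset.sum_range_succ]
      linarith
  have h := key n le_rfl
  simp only [cylinder_self, cylinder_zero, Finset.sum_singleton] at h
  have h1 : 0 ≤ 2 * 2 ^ 0 * (∑ z, a z) ^ 2 := by positivity
  have h2 : 0 ≤ 2 ^ n * a s ^ 2 := by positivity
  linarith

/-- The adversary weight of a pair of strings: `2 ^ (k + 1)` if they first differ at `k`, and `0`
if they are equal. It is inversely proportional to the number `2 ^ (n - k - 1)` of strings
that first differ at `k` from a given string. -/
def weight {n : ℕ} (z z' : Fin n → Bool) : ℝ :=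
  ∑ k : Fin n, if SplitAt z z' k then 2 ^ (k.val + 1) else 0

theorem weight_nonneg {n : ℕ} (z z' : Fin n → Bool) : 0 ≤ weight z z' :=
  Finset.sum_nonneg fun k _ => by split_ifs <;> positivity

theorem weight_self {n : ℕ} (z : Fin n → Bool) : weight z z = 0 := by
  simp [weight, SplitAt]

theorem sum_weight {n : ℕ} (z : Fin n → Bool) : ∑ z', weight z z' = n * 2 ^ n := by
  simp only [weight]
  rw [Finset.sum_comm]
  have h : ∀ k : Fin n, ∑ z', (if SplitAt z z' k then (2 : ℝ) ^ (k.val + 1) else 0) = 2 ^ n := by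
    intro k
    rw [← two_pow_mul_card_branch z k.2, ← Finset.sum_filter, Finset.sum_const, nsmul_eq_mul,
      mul_comm]
    congr 3
    ext z'
    simp [mem_branch]
  simp [h]

/-- If all pairs in `E` split at a prefix of `s`, then the adversary weight restricted to `E` is a
bilinear form of norm at most `5 * 2 ^ n`. -/
theorem sum_weight_mul_le {n : ℕ} (s : Fin n → Bool) (E : (Fin n → Bool) → (Fin n → Bool) → Prop)
    [∀ z z', Decidable (E z z')]
    (hE : ∀ z z' k, E z z' → SplitAt z z' k → ∀ i < k, z i = s i)
    (a : (Fin n → Bool) → ℝ) (ha : ∀ z, 0 ≤ a z) :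
    ∑ z, ∑ z', weight z z' * (if E z z' then a z * a z' else 0) ≤ 5 * 2 ^ n * ∑ z, a z ^ 2 := by
  refine le_trans ?_ (sum_two_pow_mul_branch_mul_cylinder_le s a)
  rw [← Fin.sum_univ_eq_sum_range (fun k : ℕ => (2 : ℝ) ^ (k + 1) *
    (2 * ((∑ z ∈ branch s k, a z) * ∑ z ∈ cylinder s (k + 1), a z))) n]
  -- a pair of `E` that splits at `k` has one string in the branch and one in the cylinder
  have hpt : ∀ z z' (k : Fin n), (if SplitAt z z' k then (2 : ℝ) ^ (k.val + 1) else 0) *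
      (if E z z' then a z * a z' else 0) ≤
      2 ^ (k.val + 1) *
        ((if z ∈ branch s k then a z else 0) * (if z' ∈ cylinder s (k + 1) then a z' else 0) +
        (if z ∈ cylinder s (k + 1) then a z else 0) * (if z' ∈ branch s k then a z' else 0)) := by
    intro z z' k
    have hz := ha z
    have hz' := ha z'
    have hnn : 0 ≤ (2 : ℝ) ^ (k.val + 1) *
        ((if z ∈ branch s k then a z else 0) * (if z' ∈ cylinder s (k + 1) then a z' else 0) +
        (if z ∈ cylinder s (k + 1) then a z else 0) *
          (if z' ∈ branch s k then a z' else 0)) := by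
      split_ifs <;> positivity
    by_cases hs : SplitAt z z' k
    · by_cases he : E z z'
      · have h1 := hE z z' k he hs
        have h2 : ∀ i < k, z' i = s i := fun i hi => (hs.1 i hi).symm.trans (h1 i hi)
        rw [if_pos hs, if_pos he]
        refine mul_le_mul_of_nonneg_left ?_ (by positivity)
        by_cases hk : z k = s k
        · have hk' : z' k ≠ s k := fun h => hs.2 (hk.trans h.symm)
          rw [if_pos (mem_cylinder_succ.2 ⟨h1, hk⟩),
            if_pos (mem_branch.2 ⟨fun i hi => (h2 i hi).symm, hk'.symm⟩)]
          refine le_add_of_nonneg_left ?_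
          split_ifs <;> positivity
        · have hk' : z' k = s k := by
            have := hs.2
            revert this hk
            cases z k <;> cases z' k <;> cases s k <;> simp
          rw [if_pos (mem_cylinder_succ.2 ⟨h2, hk'⟩),
            if_pos (mem_branch.2 ⟨fun i hi => (h1 i hi).symm, Ne.symm hk⟩)]
          refine le_add_of_nonneg_right ?_
          split_ifs <;> positivity
      · rw [if_neg he, mul_zero]
        exact hnn
    · rw [if_neg hs, zero_mul]
      exact hnn
  calc ∑ z, ∑ z', weight z z' * (if E z z' then a z * a z' else 0)
      = ∑ k : Fin n, ∑ z, ∑ z', (if SplitAt z z' k then (2 : ℝ) ^ (k.val + 1) else 0) *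
          (if E z z' then a z * a z' else 0) := by
        simp only [weight, Finset.sum_mul]
        rw [Finset.sum_comm]
        simp_rw [Finset.sum_comm (s := Finset.univ (α := Fin n))]
        rw [Finset.sum_comm]
    _ ≤ _ := Finset.sum_le_sum fun k _ => Finset.sum_le_sum fun z _ =>
        Finset.sum_le_sum fun z' _ => hpt z z' k
    _ = _ := by
        refine Finset.sum_congr rfl fun k _ => ?_
        simp only [← Finset.mul_sum, Finset.sum_add_distrib, ← Finset.sum_mul,
          Finset.sum_ite_mem, Finset.univ_inter]
        ring

/-! ### Query algorithms with permutation oracles -/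

/-- The permutation matrix of `σ`, as a unitary. -/
def permUnitary {R : Type} [Fintype R] [DecidableEq R] (σ : Equiv.Perm R) :
    Matrix.unitaryGroup R ℂ :=
  ⟨σ.permMatrix ℂ, by
    rw [Matrix.mem_unitaryGroup_iff, Matrix.star_eq_conjTranspose,
      Matrix.conjTranspose_permMatrix, ← Matrix.permMatrix_mul, inv_mul_cancel,
      Matrix.permMatrix_one]⟩

theorem permUnitary_inv {R : Type} [Fintype R] [DecidableEq R] (σ : Equiv.Perm R) :
    (permUnitary σ)⁻¹ = permUnitary σ⁻¹ :=
  Subtype.ext (Matrix.conjTranspose_permMatrix σ)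

theorem permUnitary_zpow_sign {R : Type} [Fintype R] [DecidableEq R] (σ : Equiv.Perm R)
    (s : SignType) : permUnitary σ ^ (s : ℤ) = permUnitary (σ ^ (s : ℤ)) := by
  cases s
  · change permUnitary σ ^ (0 : ℤ) = permUnitary (σ ^ (0 : ℤ))
    rw [zpow_zero, zpow_zero]
    exact Subtype.ext Matrix.permMatrix_one.symm
  · change permUnitary σ ^ (-1 : ℤ) = permUnitary (σ ^ (-1 : ℤ))
    rw [zpow_neg_one, zpow_neg_one, permUnitary_inv]
  · change permUnitary σ ^ (1 : ℤ) = permUnitary (σ ^ (1 : ℤ))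
    rw [zpow_one, zpow_one]

/-- The permutation of the basis states of an algorithm that one query to the permutation `σ`
performs, the control register holding the exponent of `σ`. -/
def controlled {R : Type} (Work : Type) (σ : Equiv.Perm R) :
    Equiv.Perm (SignType × R × Work) :=
  Equiv.prodShear (Equiv.refl SignType) fun s =>
    Equiv.prodCongr (σ ^ (s : ℤ)) (Equiv.refl Work)

theorem controlled_apply {R Work : Type} (σ : Equiv.Perm R) (b : SignType × R × Work) :
    controlled Work σ b = (b.1, (σ ^ (b.1 : ℤ)) b.2.1, b.2.2) := rfl

theorem queryOp_permUnitary_mulVec {R O : Type} [Fintype R] [DecidableEq R]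
    (A : QueryAlgorithm R O) (σ : Equiv.Perm R) (x : SignType × R × A.Work → ℂ) :
    (A.queryOp (permUnitary σ)).mulVec x = x ∘ controlled A.Work σ := by
  rw [← Matrix.permMatrix_mulVec]
  congr 1
  ext b b'
  rw [QueryAlgorithm.queryOp, Matrix.of_apply, permUnitary_zpow_sign]
  simp only [permUnitary, Equiv.Perm.permMatrix, PEquiv.toMatrix_apply, Equiv.toPEquiv_apply,
    Option.mem_def, Option.some.injEq, controlled_apply, Prod.ext_iff]
  split_ifs <;> grind

theorem norm_mulVec_unitary {B : Type} [Fintype B] [DecidableEq B] (U : Matrix.unitaryGroup B ℂ)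
    (x : B → ℂ) : ‖WithLp.toLp 2 (U.1.mulVec x)‖ = ‖WithLp.toLp 2 x‖ := by
  rw [← sq_eq_sq₀ (norm_nonneg _) (norm_nonneg _)]
  have key : ∀ y : B → ℂ, ((‖WithLp.toLp 2 y‖ ^ 2 : ℝ) : ℂ) = star y ⬝ᵥ y := by
    intro y
    rw [EuclideanSpace.norm_sq_eq, dotProduct]
    push_cast
    refine Finset.sum_congr rfl fun b _ => ?_
    rw [Pi.star_apply, Complex.star_def, mul_comm, Complex.mul_conj, Complex.normSq_eq_norm_sq]
    push_cast
    rfl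
  have h2 : ((‖WithLp.toLp 2 (U.1.mulVec x)‖ ^ 2 : ℝ) : ℂ) = ((‖WithLp.toLp 2 x‖ ^ 2 : ℝ) : ℂ) := by
    rw [key, key, Matrix.star_mulVec, Matrix.dotProduct_mulVec, Matrix.vecMul_vecMul,
      ← Matrix.star_eq_conjTranspose, Matrix.mem_unitaryGroup_iff'.1 U.2, Matrix.vecMul_one]
  exact_mod_cast h2

theorem norm_comp_perm {B : Type} [Fintype B] (π : Equiv.Perm B) (x : B → ℂ) :
    ‖WithLp.toLp 2 (x ∘ π)‖ = ‖WithLp.toLp 2 x‖ := by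
  rw [EuclideanSpace.norm_eq, EuclideanSpace.norm_eq]
  congr 1
  exact Equiv.sum_comp π fun b => ‖x b‖ ^ 2

theorem norm_state_permUnitary {R O : Type} [Fintype R] [DecidableEq R] (A : QueryAlgorithm R O)
    (σ : Equiv.Perm R) (t : ℕ) : ‖WithLp.toLp 2 (A.state (permUnitary σ) t)‖ = 1 := by
  induction t with
  | zero =>
    rw [QueryAlgorithm.state, norm_mulVec_unitary]
    simp
  | succ t ih =>
    rw [QueryAlgorithm.state, norm_mulVec_unitary, queryOp_permUnitary_mulVec, norm_comp_perm, ih]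

/-- The part of the state `x` on the basis states `b` with `q b = v`. -/
def fiberPart {B V : Type} [DecidableEq V] (q : B → V) (v : V) (x : B → ℂ) : B → ℂ :=
  fun b => if q b = v then x b else 0

theorem sum_norm_fiberPart_sq {B V : Type} [Fintype B] [Fintype V] [DecidableEq V] (q : B → V)
    (x : B → ℂ) : ∑ v, ‖WithLp.toLp 2 (fiberPart q v x)‖ ^ 2 = ‖WithLp.toLp 2 x‖ ^ 2 := by
  simp only [EuclideanSpace.norm_sq_eq]
  rw [Finset.sum_comm]
  refine Finset.sum_congr rfl fun b _ => ?_
  rw [Finset.sum_eq_single (q b)]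
  · simp [fiberPart]
  · intro v _ hv
    simp [fiberPart, hv.symm]
  · simp

/-- If `π` and `π'` agree on the fibers of `q` outside `E`, then only the fibers in `E`
contribute to the increase of the distance between the two states. -/
theorem norm_comp_sub_comp_sq_le {B V : Type} [Fintype B] [Fintype V] [DecidableEq V]
    (q : B → V) (π π' : Equiv.Perm B) (hπ : ∀ b, q (π b) = q b) (hπ' : ∀ b, q (π' b) = q b)
    (E : V → Prop) [DecidablePred E] (hE : ∀ b, ¬E (q b) → π b = π' b) (x x' : B → ℂ) :
    ‖WithLp.toLp 2 (x ∘ π - x' ∘ π')‖ ^ 2 ≤ ‖WithLp.toLp 2 (x - x')‖ ^ 2 +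
      4 * ∑ v, if E v then
        ‖WithLp.toLp 2 (fiberPart q v x)‖ * ‖WithLp.toLp 2 (fiberPart q v x')‖ else 0 := by
  rw [← sum_norm_fiberPart_sq q, ← sum_norm_fiberPart_sq q (x - x'), Finset.mul_sum,
    ← Finset.sum_add_distrib]
  refine Finset.sum_le_sum fun v _ => ?_
  have hsub : ∀ y y' : B → ℂ, fiberPart q v (y - y') = fiberPart q v y - fiberPart q v y' := by
    intro y y'
    ext b
    simp only [fiberPart, Pi.sub_apply]
    split_ifs <;> simp
  have hc : fiberPart q v (x ∘ π) = fiberPart q v x ∘ π := by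
    ext b
    simp [fiberPart, hπ]
  have hc' : fiberPart q v (x' ∘ π') = fiberPart q v x' ∘ π' := by
    ext b
    simp [fiberPart, hπ']
  split_ifs with hv
  · rw [hsub, hsub, hc, hc', WithLp.toLp_sub, WithLp.toLp_sub]
    have h1 := norm_sub_le (WithLp.toLp 2 (fiberPart q v x ∘ π))
      (WithLp.toLp 2 (fiberPart q v x' ∘ π'))
    rw [norm_comp_perm, norm_comp_perm] at h1
    have h2 := abs_norm_sub_norm_le (WithLp.toLp 2 (fiberPart q v x))
      (WithLp.toLp 2 (fiberPart q v x'))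
    have h3 := pow_le_pow_left₀ (norm_nonneg _) h1 2
    have h4 := pow_le_pow_left₀ (abs_nonneg _) h2 2
    rw [sq_abs] at h4
    linarith
  · have h : fiberPart q v x' ∘ π' = fiberPart q v x' ∘ π := by
      ext b
      by_cases hb : q b = v
      · simp only [Function.comp_apply, hE b (hb ▸ hv)]
      · simp [fiberPart, hπ, hπ', hb]
    rw [hsub, hsub, hc, hc', h, mul_zero, add_zero]
    exact (congrArg (· ^ 2) (norm_comp_perm π (fiberPart q v x - fiberPart q v x'))).le

/-- States that give outcomes in two disjoint sets with probabilities `1 / 2 + g / 2` are at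
distance at least `g / 2`. -/
theorem sq_le_norm_sub_sq_of_disjoint {B : Type} [Fintype B] (P P' : Set B) (hP : Disjoint P P')
    {g : ℝ} (hg : 0 < g) (x x' : B → ℂ) (hx : ‖WithLp.toLp 2 x‖ = 1)
    (hx' : ‖WithLp.toLp 2 x'‖ = 1)
    (h : (1 + g) / 2 ≤ ∑ b, P.indicator (fun b => ‖x b‖ ^ 2) b)
    (h' : (1 + g) / 2 ≤ ∑ b, P'.indicator (fun b => ‖x' b‖ ^ 2) b) :
    g ^ 2 / 4 ≤ ‖WithLp.toLp 2 (x - x')‖ ^ 2 := by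
  classical
  have e : ∀ y : B → ℂ, ‖WithLp.toLp 2 y‖ ^ 2 = ∑ b, ‖y b‖ ^ 2 :=
    fun y => EuclideanSpace.norm_sq_eq _
  have hx2 := e x
  have hx2' := e x'
  rw [hx, one_pow] at hx2
  rw [hx', one_pow] at hx2'
  rw [e]
  -- `|x|² - |x'|² ≤ |x - x'| (|x| + |x'|)` on `P`, and the product is split by the weighted
  -- arithmetic-geometric mean inequality
  have hpt : ∀ b, g * P.indicator (fun b => ‖x b‖ ^ 2) b ≤ g * (‖x' b‖ ^ 2 -
      P'.indicator (fun b => ‖x' b‖ ^ 2) b) + (2 * ‖(x - x') b‖ ^ 2 +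
        g ^ 2 / 4 * (‖x b‖ ^ 2 + ‖x' b‖ ^ 2)) := by
    intro b
    have h0 : 0 ≤ 2 * ‖(x - x') b‖ ^ 2 + g ^ 2 / 4 * (‖x b‖ ^ 2 + ‖x' b‖ ^ 2) := by positivity
    by_cases hb : b ∈ P
    · have hb' : b ∉ P' := Set.disjoint_left.1 hP hb
      rw [Set.indicator_of_mem hb, Set.indicator_of_notMem hb']
      have h1 : ‖x b‖ ≤ ‖x' b‖ + ‖(x - x') b‖ := by
        have := norm_add_le (x' b) ((x - x') b)
        rwa [Pi.sub_apply, add_sub_cancel] at this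
      have h2 : g * (‖x b‖ ^ 2 - ‖x' b‖ ^ 2) ≤ g * (‖(x - x') b‖ * (‖x b‖ + ‖x' b‖)) := by
        refine mul_le_mul_of_nonneg_left ?_ hg.le
        have := mul_le_mul_of_nonneg_right (sub_le_iff_le_add'.2 h1)
          (add_nonneg (norm_nonneg (x b)) (norm_nonneg (x' b)))
        linarith
      have h3 := sq_nonneg (2 * ‖(x - x') b‖ - g / 2 * (‖x b‖ + ‖x' b‖))
      have h4 := mul_nonneg (sq_nonneg g) (sq_nonneg (‖x b‖ - ‖x' b‖))
      nlinarith
    · rw [Set.indicator_of_notMem hb, mul_zero]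
      refine add_nonneg (mul_nonneg hg.le (sub_nonneg.2 ?_)) h0
      exact Set.indicator_le_self' (fun _ _ => by positivity) b
  have hsum := Finset.sum_le_sum fun b (_ : b ∈ Finset.univ) => hpt b
  simp only [Finset.sum_add_distrib, ← Finset.mul_sum, Finset.sum_sub_distrib] at hsum
  rw [← hx2, ← hx2'] at hsum
  have h5 := mul_le_mul_of_nonneg_left h hg.le
  have h6 := mul_le_mul_of_nonneg_left h' hg.le
  linarith

/-- The permutation `|x, y, w⟩ ↦ |x, (y₀ f(x)) y, w⟩`, where `(y₀ f(x))` is a transposition: it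
writes the answer `f x` into a blank answer register, and is its own inverse. -/
def answerPerm {X Y W : Type} [DecidableEq Y] (y₀ : Y) (f : X → Y) : Equiv.Perm (X × Y × W) :=
  Equiv.prodShear (Equiv.refl X) fun x => Equiv.prodCongr (Equiv.swap y₀ (f x)) (Equiv.refl W)

theorem answerPerm_apply {X Y W : Type} [DecidableEq Y] (y₀ : Y) (f : X → Y) (r : X × Y × W) :
    answerPerm y₀ f r = (r.1, Equiv.swap y₀ (f r.1) r.2.1, r.2.2) := rfl

theorem answerPerm_inv {X Y W : Type} [DecidableEq Y] (y₀ : Y) (f : X → Y) :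
    (answerPerm y₀ f : Equiv.Perm (X × Y × W))⁻¹ = answerPerm y₀ f := by
  rw [inv_eq_iff_mul_eq_one]
  ext1 r
  simp [answerPerm_apply]

theorem answerPerm_zpow_sign {X Y W : Type} [DecidableEq Y] (y₀ : Y) (f : X → Y) (s : SignType) :
    (answerPerm y₀ f : Equiv.Perm (X × Y × W)) ^ (s : ℤ) =
      if s = 0 then 1 else answerPerm y₀ f := by
  cases s
  · exact zpow_zero _
  · exact (zpow_neg_one _).trans (answerPerm_inv y₀ f)
  · exact zpow_one _

theorem isRelationalOracle_answerPerm {X Y W : Type} [Fintype X] [DecidableEq X] [Fintype Y]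
    [DecidableEq Y] [Fintype W] [DecidableEq W] (y₀ : Y) (w₀ : W) (F : X → Set Y) (f : X → Y)
    (hf : ∀ x, f x ∈ F x) :
    IsRelationalOracle y₀ w₀ F 0 (permUnitary (answerPerm y₀ f)) := by
  classical
  refine ⟨fun x y => if y = f x then 1 else 0, fun _ _ w => if w = w₀ then 1 else 0,
    fun x y => ?_, fun x x' y w => ?_, fun x => ?_⟩
  · rw [Finset.sum_eq_single w₀] <;> simp +contextual
  · have h : Equiv.swap y₀ (f x') y = y₀ ↔ y = f x' := by
      rw [Equiv.swap_apply_eq_iff, Equiv.swap_apply_left]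
    simp only [permUnitary, Equiv.Perm.permMatrix, PEquiv.toMatrix_apply, Equiv.toPEquiv_apply,
      Option.mem_def, Option.some.injEq, answerPerm_apply, Prod.ext_iff, h]
    by_cases hx : x' = x
    · subst hx
      split_ifs <;> simp_all
    · simp [hx]
  · rw [sub_zero, Finset.sum_eq_single (f x)]
    · simp [hf x]
    · intro y _ hy
      simp [hy]
    · simp

/-! ### The adversary bound -/

/-- An algorithm that identifies every string `z` with a bias `g` makes at least `g ^ 2 / 80 * n`
queries, if each query can only distinguish pairs of strings that split at a prefix of some string
`s` that depends on the query. -/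
theorem le_queries_of_identifies {n : ℕ} {V Y W O : Type} [Fintype V] [DecidableEq V] [Fintype Y]
    [DecidableEq Y] [Fintype W] [DecidableEq W] (y₀ : Y) (f : (Fin n → Bool) → V → Y)
    (hf : ∀ v, ∃ s : Fin n → Bool, ∀ z z' k, f z v ≠ f z' v → SplitAt z z' k →
      ∀ i < k, z i = s i)
    (A : QueryAlgorithm (V × Y × W) O) (S : (Fin n → Bool) → Set O)
    (hS : ∀ z z', z ≠ z' → Disjoint (S z) (S z')) {g : ℝ} (hg : 0 < g)
    (hA : ∀ z, (1 + g) / 2 ≤ A.outputProb (permUnitary (answerPerm y₀ (f z))) (S z)) :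
    g ^ 2 / 80 * n ≤ A.queries := by
  set x : (Fin n → Bool) → ℕ → SignType × (V × Y × W) × A.Work → ℂ :=
    fun z => A.state (permUnitary (answerPerm y₀ (f z))) with hx
  set D : ℕ → ℝ := fun t => ∑ z, ∑ z', weight z z' * ‖WithLp.toLp 2 (x z t - x z' t)‖ ^ 2
    with hD
  have hnorm : ∀ z t, ‖WithLp.toLp 2 (x z t)‖ = 1 := fun z t => norm_state_permUnitary A _ t
  set q : SignType × (V × Y × W) × A.Work → V := fun b => b.2.1.1 with hq
  have hπ : ∀ z b, q (controlled A.Work (answerPerm y₀ (f z)) b) = q b := by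
    intro z b
    simp only [hq, controlled_apply, answerPerm_zpow_sign]
    split_ifs <;> simp [answerPerm_apply]
  have hππ : ∀ z z' b, ¬f z (q b) ≠ f z' (q b) →
      controlled A.Work (answerPerm y₀ (f z)) b = controlled A.Work (answerPerm y₀ (f z')) b := by
    intro z z' b hb
    simp only [hq, not_not] at hb
    simp only [controlled_apply, answerPerm_zpow_sign]
    split_ifs <;> simp [answerPerm_apply, hb]
  have hstep : ∀ t, D (t + 1) ≤ D t + 20 * (2 ^ n * 2 ^ n) := by
    intro t
    set a : V → (Fin n → Bool) → ℝ := fun v z => ‖WithLp.toLp 2 (fiberPart q v (x z t))‖ with ha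
    have h1 : ∀ z z', ‖WithLp.toLp 2 (x z (t + 1) - x z' (t + 1))‖ ^ 2 ≤
        ‖WithLp.toLp 2 (x z t - x z' t)‖ ^ 2 +
          4 * ∑ v, if f z v ≠ f z' v then a v z * a v z' else 0 := by
      intro z z'
      simp only [hx, QueryAlgorithm.state]
      rw [← Matrix.mulVec_sub, norm_mulVec_unitary, queryOp_permUnitary_mulVec,
        queryOp_permUnitary_mulVec]
      exact norm_comp_sub_comp_sq_le q _ _ (hπ z) (hπ z') (fun v => f z v ≠ f z' v)
        (hππ z z') _ _
    have h2 : ∀ v, ∑ z, ∑ z', weight z z' * (if f z v ≠ f z' v then a v z * a v z' else 0) ≤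
        5 * 2 ^ n * ∑ z, a v z ^ 2 := by
      intro v
      obtain ⟨s, hs⟩ := hf v
      exact sum_weight_mul_le s (fun z z' => f z v ≠ f z' v) hs (a v) fun z => norm_nonneg _
    calc D (t + 1) ≤ ∑ z, ∑ z', weight z z' * (‖WithLp.toLp 2 (x z t - x z' t)‖ ^ 2 +
          4 * ∑ v, if f z v ≠ f z' v then a v z * a v z' else 0) :=
          Finset.sum_le_sum fun z _ => Finset.sum_le_sum fun z' _ =>
            mul_le_mul_of_nonneg_left (h1 z z') (weight_nonneg z z')
      _ = D t + 4 * ∑ v, ∑ z, ∑ z',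
            weight z z' * (if f z v ≠ f z' v then a v z * a v z' else 0) := by
          rw [Finset.sum_comm (s := (Finset.univ : Finset V))]
          simp_rw [Finset.sum_comm (s := (Finset.univ : Finset V)), mul_add,
            Finset.sum_add_distrib, hD, Finset.mul_sum]
          congr 1
          refine Finset.sum_congr rfl fun z _ => Finset.sum_congr rfl fun z' _ =>
            Finset.sum_congr rfl fun v _ => ?_
          ring
      _ ≤ D t + 4 * ∑ v, 5 * 2 ^ n * ∑ z, a v z ^ 2 := by
          gcongr with v
          exact h2 v
      _ = D t + 20 * (2 ^ n * 2 ^ n) := by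
          rw [← Finset.mul_sum, Finset.sum_comm]
          simp only [ha, sum_norm_fiberPart_sq, hnorm]
          simp
          ring
  have hzero : D 0 = 0 := by
    simp [hD, hx, QueryAlgorithm.state]
  have hle : ∀ t : ℕ, D t ≤ t * (20 * (2 ^ n * 2 ^ n)) := by
    intro t
    induction t with
    | zero => simp [hzero]
    | succ t ih =>
      have := hstep t
      push_cast
      linarith
  have hfinal : g ^ 2 / 4 * (n * (2 ^ n * 2 ^ n)) ≤ D A.queries := by
    have h1 : ∀ z z', weight z z' * (g ^ 2 / 4) ≤
        weight z z' * ‖WithLp.toLp 2 (x z A.queries - x z' A.queries)‖ ^ 2 := by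
      intro z z'
      rcases eq_or_ne z z' with rfl | hne
      · simp [weight_self]
      · exact mul_le_mul_of_nonneg_left (sq_le_norm_sub_sq_of_disjoint _ _
          ((hS z z' hne).preimage A.output) hg _ _ (hnorm z _) (hnorm z' _) (hA z) (hA z'))
          (weight_nonneg z z')
    refine le_trans (le_of_eq ?_) (Finset.sum_le_sum fun z _ => Finset.sum_le_sum fun z' _ =>
      h1 z z')
    simp only [← Finset.sum_mul, sum_weight]
    simp
    ring
  have h := hfinal.trans (hle A.queries)
  have hpos : (0 : ℝ) < 2 ^ n * 2 ^ n := by positivity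
  have h' : (g ^ 2 / 4 * n) * (2 ^ n * 2 ^ n) ≤ (A.queries * 20) * (2 ^ n * 2 ^ n) := by
    linarith
  have := le_of_mul_le_mul_right h' hpos
  linarith

/-! ### Boxes around the vertices of the cube -/

theorem norm_toLp_top_le_iff {n : ℕ} (u : Fin n → ℝ) {r : ℝ} (hr : 0 ≤ r) :
    ‖WithLp.toLp ∞ u‖ ≤ r ↔ ∀ i, |u i| ≤ r := by
  refine ⟨fun h i => (PiLp.norm_apply_le (WithLp.toLp ∞ u) i).trans h, fun h => ?_⟩
  rw [PiLp.norm_eq_ciSup]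
  exact Real.iSup_le h hr

/-- The vertex of `{-1, 1}ⁿ` that encodes the string `z`. -/
def vertex {n : ℕ} (z : Fin n → Bool) : Fin n → ℝ := fun i => if z i then 1 else -1

/-- The box `B_∞(c, 1/3)`. -/
def box {n : ℕ} (c : Fin n → ℝ) : Set (Fin n → ℝ) := ballAround ∞ {c} (1 / 3)

theorem mem_box {n : ℕ} {c y : Fin n → ℝ} : y ∈ box c ↔ ∀ i, |y i - c i| ≤ 1 / 3 := by
  simp only [box, ballAround, Set.mem_singleton_iff, exists_eq_left, Set.mem_ofPred_eq]
  exact norm_toLp_top_le_iff (y - c) (by norm_num)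

theorem admissible_box {n : ℕ} (z : Fin n → Bool) : Admissible (box (vertex z)) := by
  refine ⟨fun x hx y hy a b ha hb hab => ?_, fun y hy => ?_, vertex z, le_rfl⟩
  · rw [mem_box] at *
    intro i
    have h : (a • x + b • y) i - vertex z i =
        a * (x i - vertex z i) + b * (y i - vertex z i) := by
      simp only [Pi.add_apply, Pi.smul_apply, smul_eq_mul]
      linear_combination vertex z i * hab
    rw [h]
    calc _ ≤ |a * (x i - vertex z i)| + |b * (y i - vertex z i)| := abs_add_le _ _
      _ = a * |x i - vertex z i| + b * |y i - vertex z i| := by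
        rw [abs_mul, abs_mul, abs_of_nonneg ha, abs_of_nonneg hb]
      _ ≤ a * (1 / 3) + b * (1 / 3) := by
        gcongr
        · exact hx i
        · exact hy i
      _ = 1 / 3 := by rw [← add_mul, hab, one_mul]
  · refine ⟨0, rfl, (norm_toLp_top_le_iff _ (by norm_num)).2 fun i => ?_⟩
    have h := abs_le.1 (mem_box.1 hy i)
    rw [Pi.sub_apply, Pi.zero_apply, sub_zero, abs_le]
    unfold vertex at h
    split_ifs at h <;> constructor <;> linarith

theorem ballAround_zero {n : ℕ} (C : Set (Fin n → ℝ)) : ballAround 2 C 0 = C := by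
  ext x
  simp only [ballAround, Set.mem_ofPred_eq, norm_le_zero_iff]
  constructor
  · rintro ⟨y, hy, h⟩
    rw [sub_eq_zero.1 ((WithLp.toLp_eq_zero 2).1 h)]
    exact hy
  · intro hx
    exact ⟨x, hx, by simp⟩

theorem innerPart_zero {n : ℕ} (C : Set (Fin n → ℝ)) : innerPart 2 C 0 = C := by
  ext x
  simp [innerPart, ballAround_zero]

theorem ballAround_two_subset_ballAround_top {n : ℕ} (C : Set (Fin n → ℝ)) {ε : ℝ}
    (hε : ε ≤ 1 / 7) : ballAround 2 C ε ⊆ ballAround ∞ C (1 / 7) := by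
  rintro x ⟨y, hy, h⟩
  exact ⟨y, hy, (norm_toLp_top_le_iff _ (by norm_num)).2 fun i =>
    ((PiLp.norm_apply_le (WithLp.toLp 2 (x - y)) i).trans h).trans hε⟩

theorem vertex_mem_innerPart {n : ℕ} (z : Fin n → Bool) {ε : ℝ} (hε : ε ≤ 1 / 7) :
    vertex z ∈ innerPart 2 (box (vertex z)) ε := by
  rintro x ⟨y, rfl, h⟩
  exact mem_box.2 fun i => ((PiLp.norm_apply_le (WithLp.toLp 2 (x - vertex z)) i).trans h).trans
    (hε.trans (by norm_num))

theorem disjoint_ballAround_box {n : ℕ} {z z' : Fin n → Bool} (hne : z ≠ z') :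
    Disjoint (ballAround ∞ (box (vertex z)) (1 / 7)) (ballAround ∞ (box (vertex z')) (1 / 7)) := by
  rw [Set.disjoint_left]
  rintro x ⟨y, hy, h⟩ ⟨y', hy', h'⟩
  obtain ⟨i, hi⟩ := Function.ne_iff.1 hne
  have h1 := abs_le.1 (mem_box.1 hy i)
  have h2 := abs_le.1 (mem_box.1 hy' i)
  have h3 := abs_le.1 ((norm_toLp_top_le_iff _ (by norm_num)).1 h i)
  have h4 := abs_le.1 ((norm_toLp_top_le_iff _ (by norm_num)).1 h' i)
  simp only [vertex, Pi.sub_apply] at h1 h2 h3 h4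
  cases hz : z i <;> cases hz' : z' i <;> simp [hz, hz'] at hi h1 h2 <;> linarith

theorem disjoint_optAnswers_box {n : ℕ} {z z' : Fin n → Bool} (hne : z ≠ z') {ε : ℝ}
    (hε : ε ≤ 1 / 7) (c : Fin n → ℝ) :
    Disjoint (optAnswers ε (box (vertex z)) c) (optAnswers ε (box (vertex z')) c) := by
  rw [Set.disjoint_left]
  rintro (_ | y) h h'
  · exact Set.notMem_empty _ (h ▸ vertex_mem_innerPart z hε)
  · exact Set.disjoint_left.1 (disjoint_ballAround_box hne)
      (ballAround_two_subset_ballAround_top _ hε h.1)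
      (ballAround_two_subset_ballAround_top _ hε h'.1)

/-! ### The first violated box constraint as a separation oracle -/

/-- `i` is the first coordinate in which `y` violates the constraints of `box c`. -/
def FirstViolated {n : ℕ} (c y : Fin n → ℝ) (i : Fin n) : Prop :=
  1 / 3 < |y i - c i| ∧ ∀ j < i, |y j - c j| ≤ 1 / 3

theorem FirstViolated.unique {n : ℕ} {c y : Fin n → ℝ} {i j : Fin n} (hi : FirstViolated c y i)
    (hj : FirstViolated c y j) : i = j := by
  rcases lt_trichotomy i j with h | h | h
  · exact absurd (hj.2 i h) (not_le.2 hi.1)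
  · exact h
  · exact absurd (hi.2 j h) (not_le.2 hj.1)

theorem exists_firstViolated {n : ℕ} {c y : Fin n → ℝ} {i : Fin n} (hi : 1 / 3 < |y i - c i|) :
    ∃ j ≤ i, FirstViolated c y j := by
  induction i using WellFoundedLT.induction with
  | ind i ih =>
    by_cases h : ∃ j < i, 1 / 3 < |y j - c j|
    · obtain ⟨j, hj, hj'⟩ := h
      obtain ⟨k, hk, hk'⟩ := ih j hj hj'
      exact ⟨k, hk.trans hj.le, hk'⟩
    · exact ⟨i, le_rfl, hi, fun j hj => not_lt.1 fun hj' => h ⟨j, hj, hj'⟩⟩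

open Classical in
/-- The answer of the separation oracle for `box c` that reports the first violated constraint.
The codewords `pos i` and `neg i` stand for `e_i` and `-e_i`. -/
def boxAnswer {n : ℕ} {V : Type} (pos neg : Fin n → V) (c y : Fin n → ℝ) : Option V :=
  if h : ∃ i, FirstViolated c y i then
    some (if c h.choose < y h.choose then pos h.choose else neg h.choose)
  else none

open Classical in
theorem boxAnswer_eq_some {n : ℕ} {V : Type} (pos neg : Fin n → V) {c y : Fin n → ℝ} {i : Fin n}
    (hi : FirstViolated c y i) :
    boxAnswer pos neg c y = some (if c i < y i then pos i else neg i) := by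
  have h : ∃ i, FirstViolated c y i := ⟨i, hi⟩
  rw [boxAnswer, dif_pos h, h.choose_spec.unique hi]

theorem boxAnswer_mem_sepAnswers {n : ℕ} {V : Type} (dec : V → Fin n → ℝ) {pos neg : Fin n → V}
    (hpos : ∀ i, dec (pos i) = Pi.single i 1) (hneg : ∀ i, dec (neg i) = -Pi.single i 1)
    (c y : Fin n → ℝ) : (boxAnswer pos neg c y).map dec ∈ sepAnswers 0 (box c) y := by
  by_cases h : ∃ i, FirstViolated c y i
  · obtain ⟨i, hi⟩ := h
    have hy : y ∉ innerPart 2 (box c) 0 := by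
      rw [innerPart_zero]
      exact fun hy => absurd (mem_box.1 hy i) (not_le.2 hi.1)
    rw [boxAnswer_eq_some pos neg hi, Option.map_some]
    split_ifs with hlt
    · rw [hpos]
      refine ⟨hy, by simp, fun x hx => ?_⟩
      rw [innerPart_zero] at hx
      have h1 := abs_le.1 (mem_box.1 hx i)
      have h2 := hi.1
      rw [abs_of_pos (sub_pos.2 hlt)] at h2
      rw [single_one_dotProduct, single_one_dotProduct]
      linarith
    · rw [hneg]
      refine ⟨hy, by simp, fun x hx => ?_⟩
      rw [innerPart_zero] at hx
      have h1 := abs_le.1 (mem_box.1 hx i)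
      have h2 := hi.1
      rw [abs_of_nonpos (sub_nonpos.2 (not_lt.1 hlt))] at h2
      rw [neg_dotProduct, neg_dotProduct, single_one_dotProduct, single_one_dotProduct]
      linarith
  · rw [boxAnswer, dif_neg h]
    change y ∈ ballAround 2 (box c) 0
    rw [ballAround_zero, mem_box]
    intro i
    by_contra hi
    obtain ⟨j, _, hj⟩ := exists_firstViolated (not_le.1 hi)
    exact h ⟨j, hj⟩

/-- A query `y` distinguishes two strings that split at `k` only if no constraint before `k` is
violated, and then the signs of `y` spell out their common prefix. -/
theorem eq_sign_of_boxAnswer_ne {n : ℕ} {V : Type} (pos neg : Fin n → V) (y : Fin n → ℝ)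
    {z z' : Fin n → Bool} {k : Fin n}
    (h : boxAnswer pos neg (vertex z) y ≠ boxAnswer pos neg (vertex z') y) (hk : SplitAt z z' k)
    {i : Fin n} (hi : i < k) : z i = decide (0 < y i) := by
  by_contra hne
  have hviol : 1 / 3 < |y i - vertex z i| := by
    rw [lt_abs]
    unfold vertex
    cases hz : z i <;> simp [hz] at hne ⊢
    · left; linarith
    · right; linarith
  obtain ⟨j, hj, hfirst⟩ := exists_firstViolated hviol
  have heq : ∀ l ≤ j, vertex z l = vertex z' l := fun l hl => by
    simp only [vertex, hk.1 l ((hl.trans hj).trans_lt hi)]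
  have hfirst' : FirstViolated (vertex z') y j :=
    ⟨heq j le_rfl ▸ hfirst.1, fun l hl => heq l hl.le ▸ hfirst.2 l hl⟩
  exact h (by rw [boxAnswer_eq_some _ _ hfirst, boxAnswer_eq_some _ _ hfirst', heq j le_rfl])

end ConvexOracle

end

theorem mainTheorem6 (ρ : ℝ) (hρ : ρ < 1 / 2) :
    ∃ κ : ℝ, 0 < κ ∧
      ∀ (n : ℕ) (V : Type) [Fintype V] [DecidableEq V] (dec : V → Fin n → ℝ)
        (_ : ∀ i : Fin n, (∃ v, dec v = Pi.single i 1) ∧ ∃ v, dec v = -Pi.single i 1)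
        (W : Type) [Fintype W] [DecidableEq W] (w₀ : W),
        -- finding a point in `B_∞(K, 1/7)`
        (∀ A : ConvexOracle.QueryAlgorithm (V × Option V × W) (Fin n → ℝ),
          (∀ K : Set (Fin n → ℝ), ConvexOracle.Admissible K →
            ∀ U : Matrix.unitaryGroup (V × Option V × W) ℂ,
              ConvexOracle.IsSepOracle dec w₀ 0 0 K U →
              1 - ρ ≤ A.outputProb U (ConvexOracle.ballAround ⊤ K (1 / 7))) →
          κ * n ≤ A.queries) ∧
        -- optimization in a given direction, with precision at most `1/7`
        (∀ (ε : ℝ) (_ : 0 ≤ ε) (_ : ε ≤ 1 / 7)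
          (c : Fin n → ℝ) (_ : ‖WithLp.toLp 2 c‖ = 1)
          (A : ConvexOracle.QueryAlgorithm (V × Option V × W) (Option (Fin n → ℝ))),
          (∀ K : Set (Fin n → ℝ), ConvexOracle.Admissible K →
            ∀ U : Matrix.unitaryGroup (V × Option V × W) ℂ,
              ConvexOracle.IsSepOracle dec w₀ 0 0 K U →
              1 - ρ ≤ A.outputProb U (ConvexOracle.optAnswers ε K c)) →
          κ * n ≤ A.queries) := by
  refine ⟨(1 - 2 * ρ) ^ 2 / 80, div_pos (pow_pos (by linarith) 2) (by norm_num), ?_⟩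
  intro n V _ _ dec hdec W _ _ w₀
  -- the hard sets are the boxes around the vertices of the cube, with the oracle that reports the
  -- first violated constraint
  choose pos hpos using fun i => (hdec i).1
  choose neg hneg using fun i => (hdec i).2
  set f : (Fin n → Bool) → V → Option V :=
    fun z v => ConvexOracle.boxAnswer pos neg (ConvexOracle.vertex z) (dec v)
  have hf : ∀ v, ∃ s : Fin n → Bool, ∀ z z' k, f z v ≠ f z' v → ConvexOracle.SplitAt z z' k →
      ∀ i < k, z i = s i := fun v => ⟨fun i => decide (0 < dec v i), fun _ _ _ h hk _ hi =>
    ConvexOracle.eq_sign_of_boxAnswer_ne pos neg (dec v) h hk hi⟩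
  have hU : ∀ z, ConvexOracle.IsSepOracle dec w₀ 0 0 (ConvexOracle.box (ConvexOracle.vertex z))
      (ConvexOracle.permUnitary (ConvexOracle.answerPerm none (f z))) := fun z =>
    ConvexOracle.isRelationalOracle_answerPerm none w₀ _ (f z) fun v =>
      ConvexOracle.boxAnswer_mem_sepAnswers dec hpos hneg _ _
  have hprob : (1 + (1 - 2 * ρ)) / 2 = 1 - ρ := by ring
  refine ⟨fun A hA => ?_, fun ε _ hε c _ A hA => ?_⟩
  · exact ConvexOracle.le_queries_of_identifies none f hf A _
      (fun z z' hne => ConvexOracle.disjoint_ballAround_box hne) (by linarith)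
      fun z => hprob.trans_le (hA _ (ConvexOracle.admissible_box z) _ (hU z))
  · exact ConvexOracle.le_queries_of_identifies none f hf A _
      (fun z z' hne => ConvexOracle.disjoint_optAnswers_box hne hε c) (by linarith)
      fun z => hprob.trans_le (hA _ (ConvexOracle.admissible_box z) _ (hU z))
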